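/- **Setting.** Let $G=(V,E)$ be a finite directed graph with a source, a target, and positive lazy edge weights $\hat w:E\to\mathbb R_{>0}$. Some edges are in collision; the true weight is $w(e)=\hat w(e)$ if $e$ is not in collision and $w(e)=\infty$ otherwise. Evaluating an edge means computing $w(e)$. Assume that no two distinct simple paths from the source to the same vertex have the same lazy cost (the sum of $\hat w$ over the edges of the path). Let $h^*_G(v)$ be the lazy cost of a shortest path from $v$ to the target in $G$ ($\infty$ if there is none). A heuristic $h:V\to\mathbb R$ is *consistent* if $h(\mathrm{target})=0$ and $h(u)\le \hat w(u,v)+h(v)$ for every edge $(u,v)$. **The algorithm.** LRA\* with lookahead $\alpha\in\{1,2,3,\dots\}\cup\{\infty\}$ and heuristic $h$ maintains the current graph (initially $G$) and a search tree rooted at the source, with at most one node per vertex. The node of $v$ stores its parent, the cost $c$ of the evaluated head and the lazy cost $\ell$ of the unevaluated tail of its tree path, and its budget $b\le\alpha$, the number of edges of that tail. Initially the tree consists of the source, with $c=\ell=b=0$. *Extending the $\alpha$-band* means repeating the following step until it is no longer possible: choose a node $u\ne\mathrm{target}$ of the tree with $b(u)<\alpha$ and an edge $(u,v)$ of the current graph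 such that $v$ is not in the tree or $c(u)+\ell(u)+\hat w(u,v)<c(v)+\ell(v)$; discard the subtree rooted at $v$, if there is one, and insert $v$ as a child of $u$ with entries $c(u)$, $\ell(u)+\hat w(u,v)$, $b(u)+1$. After an initial extension, each iteration proceeds as follows. Among the frontier nodes (the nodes with $b>0$ for which $b=\alpha$ or which belong to the target), pick one with minimal key $c+\ell+h$; if there is no frontier node, stop. Evaluate the first edge $(u,v)$ of the lazy tail of its tree path. * If the edge is collision-free, move it from the tail to the head of the tree paths of $v$ and of all descendants of $v$ (updating $c$, $\ell$, $b$); if $v$ is the target, stop; otherwise extend the $\alpha$-band. * If the edge is in collision, remove it from the current graph, remove the subtree rooted at $v$ from the tree, and extend the $\alpha$-band (this rewires the removed nodes). **Lemma.** Let $h_1,h_2$ be consistent heuristics with $h^*_G(v)\ge h_1(v)>h_2(v)$ for every vertex $v\ne\mathrm{target}$. Then for every lookahead $\alpha$, LRA\* has a complete (finite, halting) run with each of the two heuristics, and whenever $E_i$ is the set of edges evaluated by a complete run of LRA\* with lookahead $\alpha$ and heuristic $h_i$ ($i=1,2$), however ties between keys and the order of the extension steps are resolved, we have $E_1\subseteq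 E_2$. -/

import Mathlib

/-- A lazy shortest-path problem: a directed graph with positive lazy edge estimates `wHat`,
the set of edges that are in collision, a source and a target. -/
structure LazyProblem (V : Type*) where
  graph : Digraph V
  wHat : V → V → ℝ
  wHat_pos : ∀ u v, graph.Adj u v → 0 < wHat u v
  collides : V → V → Prop
  source : V
  target : V

/-- A node entry of the search tree (the vertex is the index of the entry): parent, cost `c` of the
evaluated part of the path, cost `l` of the lazily evaluated part, budget `b` (the number of
lazily evaluated edges). -/
structure TreeNode (V : Type*) where
  parent : Option V
  c : ℝ
  l : ℝ
  b : ℕ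

/-- The estimated cost-to-come `c + l`. -/
def TreeNode.cost {V : Type*} (n : TreeNode V) : ℝ := n.c + n.l

/-- A search tree holds at most one node per vertex. -/
abbrev SearchTree (V : Type*) := V → Option (TreeNode V)

namespace SearchTree

variable {V : Type*}

/-- The node of `v` is a child of the node of `u`. -/
def IsChild (T : SearchTree V) (u v : V) : Prop :=
  ∃ n, T v = some n ∧ n.parent = some u

/-- The node of `x` lies in the subtree rooted at the node of `v` (which includes `v`). -/
def InSubtree (T : SearchTree V) (v x : V) : Prop :=
  Relation.ReflTransGen T.IsChild v x

open Classical in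
/-- Remove the subtree rooted at `v`. -/
noncomputable def removeSubtree (T : SearchTree V) (v : V) : SearchTree V :=
  fun x => if T.InSubtree v x then none else T x

open Classical in
/-- Insert (or overwrite) the node of `v`. -/
noncomputable def insertNode (T : SearchTree V) (v : V) (n : TreeNode V) : SearchTree V :=
  fun x => if x = v then some n else T x

open Classical in
/-- Update after the edge into `v`, of cost `r`, was found to be collision-free: on the path of
`v` and of each of its descendants this edge moves from the lazy part to the evaluated part. -/
noncomputable def updateSubtree (T : SearchTree V) (v : V) (r : ℝ) : SearchTree V :=
  fun x => if T.InSubtree v x then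
    (T x).map (fun n => ⟨n.parent, n.c + r, n.l - r, n.b - 1⟩) else T x

end SearchTree

namespace LazyProblem

variable {V : Type*} (P : LazyProblem V)

open Classical in
/-- The true cost of an edge: the lazy estimate, or `∞` if the edge is in collision. -/
noncomputable def w (u v : V) : EReal := if P.collides u v then ⊤ else (P.wHat u v : EReal)

/-- A path from `u` to `v`: a sequence of vertices in which consecutive ones are joined by edges. -/
def IsPath (p : List V) (u v : V) : Prop :=
  p.IsChain P.graph.Adj ∧ p.head? = some u ∧ p.getLast? = some v

/-- The lazy cost of a path. -/
def lazyCost : List V → ℝ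
  | [] => 0
  | [_] => 0
  | u :: v :: p => P.wHat u v + lazyCost (v :: p)

/-- No two distinct simple paths from the source to the same vertex have the same lazy cost. -/
def NoTies : Prop :=
  ∀ (v : V) (p q : List V), P.IsPath p P.source v → P.IsPath q P.source v →
    p.Nodup → q.Nodup → P.lazyCost p = P.lazyCost q → p = q

/-- The optimal heuristic: the length of the shortest path in the graph from `v` to the target
(`∞` if there is no such path). -/
noncomputable def optHeuristic (v : V) : EReal :=
  ⨅ (p : List V) (_ : P.IsPath p v P.target), (P.lazyCost p : EReal)

/-- Consistency of a heuristic. -/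
def Consistent (h : V → ℝ) : Prop :=
  h P.target = 0 ∧ ∀ u v, P.graph.Adj u v → h u ≤ P.wHat u v + h v

/-- The edges of the input graph. -/
def edgeSet : Set (V × V) := {e | P.graph.Adj e.1 e.2}

/-- The node `u ↦ m` may be used to improve the path to `v`: it has budget smaller than `α`, it is
not the target, `(u, v)` is an edge of the current graph, and either `v` has no node in the tree,
or the path through `u` is cheaper than its current one. -/
def CanRelax (α : ℕ∞) (E : Set (V × V)) (T : SearchTree V) (u v : V) (m : TreeNode V) : Prop :=
  T u = some m ∧ (m.b : ℕ∞) < α ∧ u ≠ P.target ∧ (u, v) ∈ E ∧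
    ∀ n, T v = some n → m.cost + P.wHat u v < n.cost

/-- One elementary rewiring or extension of the band: the old subtree of `v`, if any, is discarded
and `v` becomes a child of `u`, with a lazily evaluated edge. -/
inductive Relax (α : ℕ∞) (E : Set (V × V)) : SearchTree V → SearchTree V → Prop
  | mk (T : SearchTree V) (u v : V) (m : TreeNode V) (hr : P.CanRelax α E T u v m) :
      Relax α E T
        ((T.removeSubtree v).insertNode v ⟨some u, m.c, m.l + P.wHat u v, m.b + 1⟩)

/-- Rewiring and extending the `α`-band: elementary steps are made until none is left, so that
every remaining leaf is a frontier node and every node has its best parent. -/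
def ExtendsTo (α : ℕ∞) (E : Set (V × V)) (T T' : SearchTree V) : Prop :=
  Relation.ReflTransGen (P.Relax α E) T T' ∧ ∀ u v m, ¬ P.CanRelax α E T' u v m

/-- The members of the frontier queue: the nodes of the band (positive budget) that have budget
`α` or belong to the target, which is never extended. -/
def IsFrontier (α : ℕ∞) (T : SearchTree V) (x : V) (n : TreeNode V) : Prop :=
  T x = some n ∧ 0 < n.b ∧ ((n.b : ℕ∞) = α ∨ x = P.target)

/-- The node of `x` may be popped: it is a frontier node with minimal key `c + l + h`. -/
def IsPopped (α : ℕ∞) (h : V → ℝ) (T : SearchTree V) (x : V) : Prop :=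
  ∃ n, P.IsFrontier α T x n ∧
    ∀ y n', P.IsFrontier α T y n' → n.cost + h x ≤ n'.cost + h y

/-- `(u, v)` is the first edge of the lazily evaluated tail of the tree path to `x`. -/
def IsFirstLazyEdge (T : SearchTree V) (x u v : V) : Prop :=
  T.InSubtree v x ∧ ∃ n, T v = some n ∧ n.parent = some u ∧ n.b = 1

/-- A state of the algorithm at the beginning of an iteration: the remaining edges of the graph,
the search tree, the edges evaluated so far, and whether a path to the target was returned. -/
structure State (V : Type*) where
  edges : Set (V × V)
  tree : SearchTree V
  evaluated : Set (V × V)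
  found : Prop

/-- One iteration of LRA* with lookahead `α` and heuristic `h`. -/
inductive Step (α : ℕ∞) (h : V → ℝ) : State V → State V → Prop
  /-- The evaluated edge is collision-free and leads to the target: stop. -/
  | reach (s : State V) (x u v : V) (hs : ¬ s.found)
      (hx : P.IsPopped α h s.tree x) (he : IsFirstLazyEdge s.tree x u v)
      (hw : P.w u v = (P.wHat u v : EReal)) (hv : v = P.target) :
      Step α h s
        ⟨s.edges, s.tree.updateSubtree v (P.wHat u v), insert (u, v) s.evaluated, True⟩
  /-- The evaluated edge is collision-free: update the subtree and extend the band. -/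
  | free (s : State V) (x u v : V) (T' : SearchTree V) (hs : ¬ s.found)
      (hx : P.IsPopped α h s.tree x) (he : IsFirstLazyEdge s.tree x u v)
      (hw : P.w u v = (P.wHat u v : EReal)) (hv : v ≠ P.target)
      (hT : P.ExtendsTo α s.edges (s.tree.updateSubtree v (P.wHat u v)) T') :
      Step α h s ⟨s.edges, T', insert (u, v) s.evaluated, False⟩
  /-- The evaluated edge is in collision: remove it, take the subtree below it off the tree,
  rewire and extend the band. -/
  | collision (s : State V) (x u v : V) (T' : SearchTree V) (hs : ¬ s.found)
      (hx : P.IsPopped α h s.tree x) (he : IsFirstLazyEdge s.tree x u v)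
      (hw : P.w u v ≠ (P.wHat u v : EReal))
      (hT : P.ExtendsTo α (s.edges \ {(u, v)}) (s.tree.removeSubtree v) T') :
      Step α h s ⟨s.edges \ {(u, v)}, T', insert (u, v) s.evaluated, False⟩

open Classical in
/-- The tree that consists of the source only. -/
noncomputable def rootTree : SearchTree V :=
  fun x => if x = P.source then some ⟨none, 0, 0, 0⟩ else none

/-- An initial state: the band has been extended from the source, nothing has been evaluated. -/
def IsInitial (α : ℕ∞) (s : State V) : Prop :=
  s.edges = P.edgeSet ∧ P.ExtendsTo α P.edgeSet P.rootTree s.tree ∧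
    s.evaluated = ∅ ∧ ¬ s.found

/-- The algorithm has stopped: a path was returned, or the frontier queue is empty. -/
def IsHalted (α : ℕ∞) (s : State V) : Prop :=
  s.found ∨ ∀ x n, ¬ P.IsFrontier α s.tree x n

/-- `E` is the set of edges evaluated by a complete run of LRA* with lookahead `α` and
heuristic `h`. -/
def IsEvaluatedSet (α : ℕ∞) (h : V → ℝ) (E : Set (V × V)) : Prop :=
  ∃ s₀ s, P.IsInitial α s₀ ∧ Relation.ReflTransGen (P.Step α h) s₀ s ∧ P.IsHalted α s ∧
    s.evaluated = E

end LazyProblem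

/-! Fix the final state `s₂` of a complete run with `h₂`. Induction along a run with `h₁` shows that
each edge it evaluates lies in `s₂.evaluated` (`IsEvaluatedSet.subset`). Only the invariant
`IsReachable` is used, so ties and the order of extension steps play no role.

Suppose `x` is popped in `s₁` and the first lazy edge of its path is not evaluated in `s₂`. By
consistency, the tree path of `x` consists of cheapest walks (`isShortest_of_isPopped`). The current
graph of `s₂` is smaller, but it still contains this path: an edge is removed only after its
evaluation, at a moment when its tail vertex is settled. Since there are no ties, the path occurs in
the tree of `s₂` with the same costs and budgets (`settled_transfer`, `child_transfer`), and `x` is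
a frontier node there. So the queue of `s₂` is not empty, and `s₂` has returned a path of some cost
`t ≤ cost x + h₂ x`. Minimality of `x` in `s₁` gives `cost x + h₁ x ≤ t`, which contradicts `h₂ x <
h₁ x` (`mem_evaluated`).

Complete runs exist because extending the band lowers a lexicographic measure (`exists_extendsTo`)
and each iteration halts, settles a vertex or deletes an edge (`exists_halted`). -/

namespace LazyProblem

variable {V : Type*} {P : LazyProblem V}

/-! ### Walks and cheapest walks -/

/-- There is a walk of lazy cost `r` from the source to `v` that uses only edges of `E`. -/
inductive Reaches (P : LazyProblem V) (E : Set (V × V)) : V → ℝ → Prop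
  | source : Reaches P E P.source 0
  | step {u v : V} {r : ℝ} : Reaches P E u r → (u, v) ∈ E → Reaches P E v (r + P.wHat u v)

/-- No walk in `E` from the source to `v` is cheaper than `r`. -/
def IsShortest (P : LazyProblem V) (E : Set (V × V)) (v : V) (r : ℝ) : Prop :=
  ∀ r', P.Reaches E v r' → r ≤ r'

theorem Reaches.mono {E F : Set (V × V)} (h : E ⊆ F) {v : V} {r : ℝ} (hr : P.Reaches E v r) :
    P.Reaches F v r := by
  induction hr with
  | source => exact .source
  | step _ he ih => exact .step ih (h he)

theorem IsShortest.anti {E F : Set (V × V)} (h : E ⊆ F) {v : V} {r : ℝ}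
    (hr : P.IsShortest F v r) : P.IsShortest E v r :=
  fun r' hr' => hr r' (hr'.mono h)

theorem lazyCost_concat (p : List V) (u v : V) :
    P.lazyCost (p ++ [u] ++ [v]) = P.lazyCost (p ++ [u]) + P.wHat u v := by
  induction p with
  | nil => simp [lazyCost]
  | cons a p ih =>
    cases p with
    | nil => simp [lazyCost]
    | cons b p =>
      simp only [List.cons_append, lazyCost] at ih ⊢
      rw [ih, add_assoc]

theorem IsPath.concat {p : List V} {s u v : V} (hp : P.IsPath (p ++ [u]) s u)
    (h : P.graph.Adj u v) : P.IsPath (p ++ [u] ++ [v]) s v := by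
  obtain ⟨h1, h2, -⟩ := hp
  refine ⟨?_, ?_, by simp⟩
  · rw [List.isChain_append]
    refine ⟨h1, by simp, ?_⟩
    simpa using h
  · rw [List.head?_append, h2]; rfl

/-- A cheapest walk is a simple path. -/
theorem Reaches.exists_simple {E : Set (V × V)} (hE : E ⊆ P.edgeSet) {v : V} {r : ℝ}
    (hr : P.Reaches E v r) (hs : P.IsShortest E v r) :
    ∃ p : List V, P.IsPath (p ++ [v]) P.source v ∧ (p ++ [v]).Nodup ∧
      P.lazyCost (p ++ [v]) = r ∧ ∀ x ∈ p ++ [v], ∃ r', P.Reaches E x r' ∧ r' ≤ r := by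
  induction hr with
  | source =>
    refine ⟨[], ⟨by simp, by simp, by simp⟩, by simp, by simp [lazyCost], ?_⟩
    intro x hx
    obtain rfl : x = P.source := by simpa using hx
    exact ⟨0, .source, le_rfl⟩
  | @step u v r hu he ih =>
    have hpos := P.wHat_pos u v (hE he)
    obtain ⟨p, hp, hn, hc, hx⟩ := ih fun r' hr' => by
      have := hs _ (.step hr' he); linarith
    refine ⟨p ++ [u], hp.concat (hE he), ?_, by rw [lazyCost_concat, hc], ?_⟩
    · rw [List.nodup_append]
      refine ⟨hn, by simp, ?_⟩
      rintro a ha b hb rfl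
      obtain rfl : a = v := by simpa using hb
      -- An earlier visit to the end vertex would be a strictly cheaper walk to it.
      obtain ⟨r', hr', hle⟩ := hx _ ha
      have := hs _ hr'
      linarith
    · intro x hmem
      rcases List.mem_append.1 hmem with h | h
      · obtain ⟨r', hr', hle⟩ := hx _ h
        exact ⟨r', hr', by linarith⟩
      · obtain rfl : x = v := by simpa using h
        exact ⟨_, .step hu he, le_rfl⟩

/-- Without ties, the last edge of a cheapest walk is unique. -/
theorem NoTies.parent_unique (hties : P.NoTies) {E : Set (V × V)} (hE : E ⊆ P.edgeSet)
    {u u' v : V} {r r' : ℝ} (hu : P.Reaches E u r) (hu' : P.Reaches E u' r')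
    (he : (u, v) ∈ E) (he' : (u', v) ∈ E) (heq : r + P.wHat u v = r' + P.wHat u' v)
    (hs : P.IsShortest E v (r + P.wHat u v)) : u = u' := by
  have key : ∀ {u r}, P.Reaches E u r → (u, v) ∈ E → P.IsShortest E v (r + P.wHat u v) →
      ∃ p : List V, P.IsPath (p ++ [u] ++ [v]) P.source v ∧ (p ++ [u] ++ [v]).Nodup ∧
        P.lazyCost (p ++ [u] ++ [v]) = r + P.wHat u v := by
    intro u r hu he hs
    obtain ⟨p, hp, hn, hc, hx⟩ := hu.exists_simple hE fun r' hr' => by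
      have := hs _ (.step hr' he); linarith
    refine ⟨p, hp.concat (hE he), ?_, by rw [lazyCost_concat, hc]⟩
    rw [List.nodup_append]
    refine ⟨hn, by simp, ?_⟩
    rintro a ha b hb rfl
    obtain rfl : a = v := by simpa using hb
    obtain ⟨r', hr', hle⟩ := hx _ ha
    have := hs _ hr'
    have := P.wHat_pos u a (hE he)
    linarith
  obtain ⟨p, hp, hn, hc⟩ := key hu he hs
  obtain ⟨q, hq, hm, hd⟩ := key hu' he' (heq ▸ hs)
  have := hties v _ _ hp hq hn hm (by rw [hc, hd, heq])
  -- The two simple paths coincide, hence so do their next-to-last vertices.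
  simpa using congrArg (fun l : List V => l.dropLast.getLast?) this

/-! ### The invariant of the search tree -/

/-- The invariant of the search tree with respect to the current graph `E` and the set `F` of
evaluated edges: nodes with `b = 0` are reached by cheapest walks of evaluated free edges. -/
structure IsSearchTree (P : LazyProblem V) (α : ℕ∞) (E F : Set (V × V)) (T : SearchTree V) :
    Prop where
  edges_subset : E ⊆ P.edgeSet
  root : ∃ n, T P.source = some n ∧ n.parent = none ∧ n.cost = 0 ∧ n.b = 0
  parent : ∀ v n, T v = some n → v ≠ P.source → ∃ u m, n.parent = some u ∧ T u = some m ∧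
    (u, v) ∈ E ∧ u ≠ P.target ∧ n.cost = m.cost + P.wHat u v ∧
    (n.b = m.b + 1 ∨ n.b = 0 ∧ m.b = 0 ∧ (u, v) ∈ F ∧ ¬ P.collides u v)
  band : ∀ v n, T v = some n → (n.b : ℕ∞) ≤ α
  settled : ∀ v n, T v = some n → n.b = 0 → P.IsShortest E v n.cost

/-- The vertex `v` has a node with empty lazy tail. -/
def Settled (T : SearchTree V) (v : V) : Prop := ∃ n, T v = some n ∧ n.b = 0

namespace IsSearchTree

variable {α : ℕ∞} {E F : Set (V × V)} {T : SearchTree V}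

theorem wHat_pos (hT : P.IsSearchTree α E F T) {u v : V} (h : (u, v) ∈ E) : 0 < P.wHat u v :=
  P.wHat_pos u v (hT.edges_subset h)

theorem of_isChild (hT : P.IsSearchTree α E F T) {u v : V} (h : T.IsChild u v) :
    ∃ n m, T v = some n ∧ n.parent = some u ∧ T u = some m ∧ (u, v) ∈ E ∧ u ≠ P.target ∧
    n.cost = m.cost + P.wHat u v ∧
    (n.b = m.b + 1 ∨ n.b = 0 ∧ m.b = 0 ∧ (u, v) ∈ F ∧ ¬ P.collides u v) := by
  obtain ⟨n, hn, hp⟩ := h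
  have hv : v ≠ P.source := by
    rintro rfl
    obtain ⟨n', hn', hp', -⟩ := hT.root
    rw [hn] at hn'
    cases hn'
    rw [hp] at hp'
    cases hp'
  obtain ⟨u', m, h1, h2, h3⟩ := hT.parent v n hn hv
  rw [hp] at h1
  cases h1
  exact ⟨n, m, hn, hp, h2, h3⟩

/-- Induction along the tree paths, from the root. -/
theorem induction [Finite V] (hT : P.IsSearchTree α E F T) {p : V → TreeNode V → Prop}
    (root : ∀ n, T P.source = some n → n.cost = 0 → n.b = 0 → p P.source n)
    (step : ∀ u m v n, T u = some m → T v = some n → n.parent = some u → (u, v) ∈ E →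
      u ≠ P.target → n.cost = m.cost + P.wHat u v →
      (n.b = m.b + 1 ∨ n.b = 0 ∧ m.b = 0 ∧ (u, v) ∈ F ∧ ¬ P.collides u v) → p u m → p v n)
    {v : V} {n : TreeNode V} (hv : T v = some n) : p v n := by
  -- Positive weights make a parent strictly cheaper than its child, and on a finite vertex set
  -- comparison of costs is well-founded.
  let r : V → V → Prop := fun a b => ∃ m n, T a = some m ∧ T b = some n ∧ m.cost < n.cost
  have : IsTrans V r := ⟨by
    rintro a b c ⟨m, n, h1, h2, h3⟩ ⟨m', n', h4, h5, h6⟩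
    rw [h2] at h4
    cases h4
    exact ⟨m, n', h1, h5, h3.trans h6⟩⟩
  have : Std.Irrefl r := ⟨by
    rintro a ⟨m, n, h1, h2, h3⟩
    rw [h1] at h2
    cases h2
    exact lt_irrefl _ h3⟩
  have wf : WellFounded r := Finite.wellFounded_of_trans_of_irrefl r
  induction v using wf.induction generalizing n with
  | h v ih =>
    by_cases hs : v = P.source
    · subst hs
      obtain ⟨n', h1, -, h2, h3⟩ := hT.root
      rw [hv] at h1
      cases h1
      exact root _ hv h2 h3
    · obtain ⟨u, m, h1, h2, h3, h4, h5, h6⟩ := hT.parent v n hv hs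
      have := hT.wHat_pos h3
      exact step u m v n h2 hv h1 h3 h4 h5 h6 (ih u ⟨m, n, h2, hv, by linarith⟩ h2)

theorem reaches [Finite V] (hT : P.IsSearchTree α E F T) {v : V} {n : TreeNode V}
    (hv : T v = some n) : P.Reaches E v n.cost := by
  refine hT.induction (p := fun v n => P.Reaches E v n.cost) ?_ ?_ hv
  · intro n _ h _
    rw [h]; exact .source
  · intro u m v n _ _ _ he _ hc _ ih
    rw [hc]; exact .step ih he

theorem cost_nonneg [Finite V] (hT : P.IsSearchTree α E F T) {v : V} {n : TreeNode V}
    (hv : T v = some n) : 0 ≤ n.cost := by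
  refine hT.induction (p := fun _ n => 0 ≤ n.cost) ?_ ?_ hv
  · intro n _ h _
    rw [h]
  · intro u m v n _ _ _ he _ hc _ ih
    have := hT.wHat_pos he
    linarith

/-- Along a tree path the cost and the key of a consistent heuristic increase, and positive
budgets increase strictly. -/
theorem of_inSubtree (hT : P.IsSearchTree α E F T) {h : V → ℝ} (hc : P.Consistent h) {v x : V}
    (hvx : T.InSubtree v x) {n : TreeNode V} (hn : T x = some n) :
    ∃ m, T v = some m ∧ m.cost ≤ n.cost ∧ m.cost + h v ≤ n.cost + h x ∧
      (v = x ∨ m.cost < n.cost ∧ v ≠ P.target ∧ (0 < m.b → m.b < n.b)) := by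
  induction hvx generalizing n with
  | refl => exact ⟨n, hn, le_rfl, le_rfl, .inl rfl⟩
  | @tail y z _ hyz ih =>
    obtain ⟨n', k, h1, -, h3, h4, h5, h6, h7⟩ := hT.of_isChild hyz
    rw [hn] at h1
    cases h1
    obtain ⟨m, g1, g2, g3, g4⟩ := ih h3
    have hw := hT.wHat_pos h4
    have := hc.2 _ _ (hT.edges_subset h4)
    refine ⟨m, g1, by linarith, by linarith, .inr ⟨by linarith, ?_, ?_⟩⟩
    · rcases g4 with rfl | ⟨-, h, -⟩ <;> assumption
    · intro hb
      rcases g4 with rfl | ⟨-, -, h⟩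
      · rw [g1] at h3
        cases h3
        omega
      · have := h hb
        omega

end IsSearchTree

/-- Makes the cost and budget parts of `of_inSubtree` available where no heuristic is at hand. -/
theorem consistent_zero (P : LazyProblem V) : P.Consistent fun _ => 0 :=
  ⟨rfl, fun u v h => by simpa using (P.wHat_pos u v h).le⟩

/-! ### Extension steps and their termination -/

/-- The tree after an elementary extension step. -/
noncomputable def relaxed (P : LazyProblem V) (T : SearchTree V) (u v : V) (m : TreeNode V) :
    SearchTree V :=
  (T.removeSubtree v).insertNode v ⟨some u, m.c, m.l + P.wHat u v, m.b + 1⟩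

theorem relaxed_self (T : SearchTree V) (u v : V) (m : TreeNode V) :
    P.relaxed T u v m v = some ⟨some u, m.c, m.l + P.wHat u v, m.b + 1⟩ := by
  simp [relaxed, SearchTree.insertNode]

theorem relaxed_of_not {T : SearchTree V} {u v x : V} {m : TreeNode V} (h : ¬ T.InSubtree v x) :
    P.relaxed T u v m x = T x := by
  have : x ≠ v := by rintro rfl; exact h .refl
  simp [relaxed, SearchTree.insertNode, SearchTree.removeSubtree, this, h]

theorem relaxed_eq_some {T : SearchTree V} {u v x : V} {m n : TreeNode V} (hx : x ≠ v) :
    P.relaxed T u v m x = some n ↔ T x = some n ∧ ¬ T.InSubtree v x := by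
  by_cases h : T.InSubtree v x <;>
    simp [relaxed, SearchTree.insertNode, SearchTree.removeSubtree, hx, h]

namespace IsSearchTree

variable {α : ℕ∞} {E F : Set (V × V)} {T : SearchTree V}

theorem lt_cost_of_inSubtree (hT : P.IsSearchTree α E F T) {u v x : V} {m n : TreeNode V}
    (hr : P.CanRelax α E T u v m) (hx : T.InSubtree v x) (hn : T x = some n) :
    m.cost + P.wHat u v < n.cost := by
  obtain ⟨k, h1, h2, -⟩ := hT.of_inSubtree P.consistent_zero hx hn
  have := hr.2.2.2.2 _ h1
  linarith

theorem not_inSubtree_of_canRelax (hT : P.IsSearchTree α E F T) {u v : V} {m : TreeNode V}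
    (hr : P.CanRelax α E T u v m) : ¬ T.InSubtree v u := by
  intro h
  have := hT.lt_cost_of_inSubtree hr h hr.1
  have := hT.wHat_pos hr.2.2.2.1
  linarith

/-- Extension steps never touch settled nodes. -/
theorem not_inSubtree_of_settled [Finite V] (hT : P.IsSearchTree α E F T) {u v x : V}
    {m n : TreeNode V} (hr : P.CanRelax α E T u v m) (hn : T x = some n) (hb : n.b = 0) :
    ¬ T.InSubtree v x := by
  intro h
  obtain ⟨k, h1, -, -, h4⟩ := hT.of_inSubtree P.consistent_zero h hn
  have hk : k.b = 0 := by
    rcases h4 with rfl | ⟨-, -, h4⟩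
    · rw [h1] at hn
      cases hn
      exact hb
    · omega
  -- The root `v` of the discarded subtree would itself be settled, hence already of cheapest cost,
  -- so no step can improve it.
  have h5 := hT.settled _ _ h1 hk _ (.step (hT.reaches hr.1) hr.2.2.2.1)
  have := hr.2.2.2.2 _ h1
  linarith

theorem relaxed_settled_iff [Finite V] (hT : P.IsSearchTree α E F T) {u v : V} {m : TreeNode V}
    (hr : P.CanRelax α E T u v m) {x : V} {n : TreeNode V} (hb : n.b = 0) :
    P.relaxed T u v m x = some n ↔ T x = some n := by
  constructor
  · intro h
    by_cases hx : x = v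
    · subst hx
      rw [relaxed_self] at h
      cases h
      simp at hb
    · exact ((relaxed_eq_some hx).1 h).1
  · intro h
    rw [relaxed_of_not (hT.not_inSubtree_of_settled hr h hb), h]

theorem relaxed [Finite V] (hT : P.IsSearchTree α E F T) {u v : V} {m : TreeNode V}
    (hr : P.CanRelax α E T u v m) : P.IsSearchTree α E F (P.relaxed T u v m) where
  edges_subset := hT.edges_subset
  root := by
    obtain ⟨n, h1, h2, h3, h4⟩ := hT.root
    exact ⟨n, (hT.relaxed_settled_iff hr h4).2 h1, h2, h3, h4⟩
  parent := by
    intro x n hx hs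
    by_cases hxv : x = v
    · subst hxv
      rw [relaxed_self] at hx
      cases hx
      refine ⟨u, m, rfl, ?_, hr.2.2.2.1, hr.2.2.1, ?_, .inl rfl⟩
      · rw [relaxed_of_not (hT.not_inSubtree_of_canRelax hr), hr.1]
      · simp only [TreeNode.cost]; ring
    · obtain ⟨h1, h2⟩ := (relaxed_eq_some hxv).1 hx
      obtain ⟨p, k, g1, g2, g3⟩ := hT.parent x n h1 hs
      refine ⟨p, k, g1, ?_, g3⟩
      rw [relaxed_of_not, g2]
      exact fun h => h2 (h.tail ⟨n, h1, g1⟩)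
  band := by
    intro x n hx
    by_cases hxv : x = v
    · subst hxv
      rw [relaxed_self] at hx
      cases hx
      exact_mod_cast Order.add_one_le_of_lt hr.2.1
    · exact hT.band x n ((relaxed_eq_some hxv).1 hx).1
  settled := fun x n hx hb => hT.settled x n ((hT.relaxed_settled_iff hr hb).1 hx) hb

theorem of_reflTransGen [Finite V] (hT : P.IsSearchTree α E F T) {T' : SearchTree V}
    (h : Relation.ReflTransGen (P.Relax α E) T T') :
    P.IsSearchTree α E F T' ∧ ∀ x n, n.b = 0 → (T' x = some n ↔ T x = some n) := by
  induction h with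
  | refl => exact ⟨hT, fun _ _ _ => Iff.rfl⟩
  | tail _ hr ih =>
    obtain ⟨u, v, m, hr⟩ := hr
    exact ⟨ih.1.relaxed hr, fun x n hb => (ih.1.relaxed_settled_iff hr hb).trans (ih.2 x n hb)⟩

/-- Costs increase strictly along a tree path, so it repeats no vertex. Hence only finitely many
node costs can ever occur. -/
theorem exists_simple [Finite V] (hT : P.IsSearchTree α E F T) {v : V} {n : TreeNode V}
    (hv : T v = some n) : ∃ p : List V, p.Nodup ∧ P.lazyCost p = n.cost := by
  have := hT.induction (p := fun v n => ∃ p : List V, (p ++ [v]).Nodup ∧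
    P.lazyCost (p ++ [v]) = n.cost ∧ ∀ x ∈ p ++ [v], ∃ k, T x = some k ∧ k.cost ≤ n.cost) ?_ ?_ hv
  · obtain ⟨p, h1, h2, -⟩ := this
    exact ⟨_, h1, h2⟩
  · intro n hn hc _
    refine ⟨[], by simp, by simp [lazyCost, hc], ?_⟩
    intro x hx
    obtain rfl : x = P.source := by simpa using hx
    exact ⟨n, hn, le_rfl⟩
  · rintro u m v n hu hv - he - hc - ⟨p, hn, hpc, hx⟩
    have hw := hT.wHat_pos he
    refine ⟨p ++ [u], ?_, by rw [lazyCost_concat, hpc, hc], ?_⟩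
    · rw [List.nodup_append]
      refine ⟨hn, by simp, ?_⟩
      rintro a ha b hb rfl
      obtain rfl : a = v := by simpa using hb
      obtain ⟨k, hk, hle⟩ := hx _ ha
      rw [hv] at hk
      cases hk
      linarith
    · intro x hmem
      rcases List.mem_append.1 hmem with h | h
      · obtain ⟨k, hk, hle⟩ := hx _ h
        exact ⟨k, hk, by linarith⟩
      · obtain rfl : x = v := by simpa using h
        exact ⟨n, hv, le_rfl⟩

/-- Extension steps can be continued until none is left. -/
theorem exists_extendsTo [Finite V] (hT : P.IsSearchTree α E F T) :
    ∃ T', P.ExtendsTo α E T T' := by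
  have hfin : (P.lazyCost '' {p : List V | p.Nodup}).Finite := by
    classical
    cases nonempty_fintype V
    exact (@Set.toFinite _ {p : List V | p.Nodup}
      (Finite.of_fintype {p : List V // p.Nodup})).image _
  let K := P.lazyCost '' {p : List V | p.Nodup}
  have : Finite K := hfin
  -- For each possible cost `r`, count the vertices without a node of cost `r`; compare
  -- lexicographically, small costs first. A step that creates a node of cost `r₀` discards only
  -- nodes dearer than `r₀`: counts below `r₀` stay, the one at `r₀` drops.
  let f : SearchTree V → Lex (K → ℕ) :=
    fun T => toLex fun r => {x | ∀ n, T x = some n → n.cost ≠ r}.ncard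
  have wf : WellFounded (InvImage (· < ·) f) := InvImage.wf f wellFounded_lt
  induction T using wf.induction with
  | h T ih =>
    by_cases hex : ∃ u v m, P.CanRelax α E T u v m
    · obtain ⟨u, v, m, hr⟩ := hex
      have hT' := hT.relaxed hr
      have hnew : (⟨some u, m.c, m.l + P.wHat u v, m.b + 1⟩ : TreeNode V).cost =
          m.cost + P.wHat u v := by
        simp only [TreeNode.cost]; ring
      obtain ⟨p, hp, hpc⟩ := hT'.exists_simple (relaxed_self T u v m)
      have same : ∀ r < m.cost + P.wHat u v, ∀ x, (∃ n, P.relaxed T u v m x = some n ∧ n.cost = r) ↔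
          ∃ n, T x = some n ∧ n.cost = r := by
        intro r hr' x
        constructor
        · rintro ⟨n, hn, hc⟩
          by_cases hx : x = v
          · subst hx
            rw [relaxed_self] at hn
            cases hn
            rw [hnew] at hc
            exact absurd hc hr'.ne'
          · exact ⟨n, ((relaxed_eq_some hx).1 hn).1, hc⟩
        · rintro ⟨n, hn, hc⟩
          refine ⟨n, ?_, hc⟩
          rw [relaxed_of_not, hn]
          intro hx
          have := hT.lt_cost_of_inSubtree hr hx hn
          linarith
      have hlt : f (P.relaxed T u v m) < f T := by
        refine ⟨⟨m.cost + P.wHat u v, p, hp, hpc.trans hnew⟩, ?_, ?_⟩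
        · rintro ⟨r, hr'⟩ hlt
          have := same r hlt
          show Set.ncard _ = Set.ncard _
          congr 1
          ext x
          have := not_congr (this x)
          push Not at this
          exact this
        · show Set.ncard _ < Set.ncard _
          refine Set.ncard_lt_ncard ?_ (Set.toFinite _)
          refine (Set.ssubset_iff_of_subset ?_).2 ⟨v, ?_, ?_⟩
          · intro x hx n hn hc
            refine hx n ?_ hc
            rw [relaxed_of_not, hn]
            intro hx
            have := hT.lt_cost_of_inSubtree hr hx hn
            exact this.ne' hc
          · intro n hn
            exact (hr.2.2.2.2 n hn).ne'
          · intro h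
            exact h _ (relaxed_self T u v m) hnew
      obtain ⟨T', h1, h2⟩ := ih _ hlt hT'
      exact ⟨T', .head (.mk T u v m hr) h1, h2⟩
    · push Not at hex
      exact ⟨T, .refl, hex⟩

end IsSearchTree

/-! ### The tree after the evaluation of an edge -/

theorem removeSubtree_eq_some {T : SearchTree V} {v x : V} {n : TreeNode V} :
    T.removeSubtree v x = some n ↔ T x = some n ∧ ¬ T.InSubtree v x := by
  by_cases h : T.InSubtree v x <;> simp [SearchTree.removeSubtree, h]

open Classical in
theorem updateSubtree_eq_some {T : SearchTree V} {v x : V} {r : ℝ} {n' : TreeNode V}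
    (h : T.updateSubtree v r x = some n') : ∃ n, T x = some n ∧ n'.parent = n.parent ∧
      n'.cost = n.cost ∧ n'.b = if T.InSubtree v x then n.b - 1 else n.b := by
  by_cases hx : T.InSubtree v x
  · simp only [SearchTree.updateSubtree, hx, if_true, Option.map_eq_some_iff] at h
    obtain ⟨n, hn, rfl⟩ := h
    refine ⟨n, hn, rfl, ?_, by simp [hx]⟩
    simp only [TreeNode.cost]; ring
  · simp only [SearchTree.updateSubtree, hx, if_false] at h
    exact ⟨n', h, rfl, rfl, by simp [hx]⟩

open Classical in
theorem exists_updateSubtree {T : SearchTree V} {v x : V} {n : TreeNode V} (r : ℝ)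
    (h : T x = some n) : ∃ n', T.updateSubtree v r x = some n' ∧ n'.parent = n.parent ∧
      n'.cost = n.cost ∧ n'.b = if T.InSubtree v x then n.b - 1 else n.b := by
  cases hx : T.updateSubtree v r x with
  | none =>
    by_cases hv : T.InSubtree v x <;> simp [SearchTree.updateSubtree, hv, h] at hx
  | some n' =>
    obtain ⟨k, h1, h2⟩ := updateSubtree_eq_some hx
    rw [h] at h1
    cases h1
    exact ⟨n', rfl, h2⟩

namespace IsSearchTree

variable {α : ℕ∞} {E F : Set (V × V)} {T : SearchTree V}

/-- Positive budgets grow strictly downwards. So moving one edge to the evaluated head settles `v`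
and no proper descendant. -/
theorem budget_of_inSubtree (hT : P.IsSearchTree α E F T) {v x : V} {n k : TreeNode V}
    (hv : T v = some n) (hb : n.b = 1) (hs : T.InSubtree v x) (hx : T x = some k) :
    v = x ∨ 2 ≤ k.b := by
  obtain ⟨m, h1, -, -, h4⟩ := hT.of_inSubtree P.consistent_zero hs hx
  rw [hv] at h1
  cases h1
  rcases h4 with h | ⟨-, -, h⟩
  · exact .inl h
  · exact .inr (by omega)

theorem not_inSubtree_root (hT : P.IsSearchTree α E F T) {u v : V} {n k : TreeNode V}
    (hv : T v = some n) (hb : n.b = 1) (hx : T u = some k) (hk : k.b = 0) :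
    ¬ T.InSubtree v u := by
  intro h
  rcases hT.budget_of_inSubtree hv hb h hx with rfl | h
  · rw [hv] at hx
    cases hx
    omega
  · omega

theorem removeSubtree (hT : P.IsSearchTree α E F T) {u v : V} {n : TreeNode V}
    (hv : T v = some n) (hb : n.b = 1) :
    P.IsSearchTree α (E \ {(u, v)}) (insert (u, v) F) (T.removeSubtree v) where
  edges_subset := Set.sdiff_subset.trans hT.edges_subset
  root := by
    obtain ⟨k, h1, h2, h3, h4⟩ := hT.root
    exact ⟨k, removeSubtree_eq_some.2 ⟨h1, hT.not_inSubtree_root hv hb h1 h4⟩, h2, h3, h4⟩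
  parent := by
    intro x k hx hs
    obtain ⟨h1, h2⟩ := removeSubtree_eq_some.1 hx
    obtain ⟨p, m, g1, g2, g3, g4, g5, g6⟩ := hT.parent x k h1 hs
    refine ⟨p, m, g1, removeSubtree_eq_some.2 ⟨g2, fun h => h2 (h.tail ⟨k, h1, g1⟩)⟩,
      ⟨g3, ?_⟩, g4, g5, g6.imp_right fun h => ⟨h.1, h.2.1, .inr h.2.2.1, h.2.2.2⟩⟩
    intro h
    cases h
    exact h2 .refl
  band := fun x k hx => hT.band x k (removeSubtree_eq_some.1 hx).1
  settled := fun x k hx h0 =>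
    (hT.settled x k (removeSubtree_eq_some.1 hx).1 h0).anti Set.sdiff_subset

theorem settled_removeSubtree (hT : P.IsSearchTree α E F T) {v x : V} {n : TreeNode V}
    (hv : T v = some n) (hb : n.b = 1) : Settled (T.removeSubtree v) x ↔ Settled T x := by
  constructor
  · rintro ⟨k, h1, h2⟩
    exact ⟨k, (removeSubtree_eq_some.1 h1).1, h2⟩
  · rintro ⟨k, h1, h2⟩
    exact ⟨k, removeSubtree_eq_some.2 ⟨h1, hT.not_inSubtree_root hv hb h1 h2⟩, h2⟩

theorem settled_updateSubtree (hT : P.IsSearchTree α E F T) {v x : V} {n : TreeNode V} (r : ℝ)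
    (hv : T v = some n) (hb : n.b = 1) :
    Settled (T.updateSubtree v r) x ↔ x = v ∨ Settled T x := by
  constructor
  · rintro ⟨k, h1, h2⟩
    obtain ⟨m, g1, -, -, g4⟩ := updateSubtree_eq_some h1
    by_cases hs : T.InSubtree v x
    · rcases hT.budget_of_inSubtree hv hb hs g1 with rfl | h
      · exact .inl rfl
      · rw [if_pos hs] at g4
        omega
    · rw [if_neg hs] at g4
      exact .inr ⟨m, g1, by omega⟩
  · rintro (rfl | ⟨k, h1, h2⟩)
    · obtain ⟨k, h1, -, -, h4⟩ := exists_updateSubtree (v := x) r hv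
      rw [if_pos .refl] at h4
      exact ⟨k, h1, by omega⟩
    · obtain ⟨k', g1, -, -, g4⟩ := exists_updateSubtree (v := v) r h1
      refine ⟨k', g1, ?_⟩
      split_ifs at g4 <;> omega

theorem updateSubtree (hT : P.IsSearchTree α E F T) {u v : V} {n : TreeNode V} (r : ℝ)
    (hv : T v = some n) (hp : n.parent = some u) (hb : n.b = 1) (hw : ¬ P.collides u v)
    (hs : P.IsShortest E v n.cost) :
    P.IsSearchTree α E (insert (u, v) F) (T.updateSubtree v r) where
  edges_subset := hT.edges_subset
  root := by
    obtain ⟨k, h1, h2, h3, h4⟩ := hT.root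
    obtain ⟨k', g1, g2, g3, g4⟩ := exists_updateSubtree (v := v) r h1
    refine ⟨k', g1, g2.trans h2, g3.trans h3, ?_⟩
    split_ifs at g4 <;> omega
  parent := by
    intro x k' hx hs
    obtain ⟨k, h1, h2, h3, h4⟩ := updateSubtree_eq_some hx
    obtain ⟨p, m, g1, g2, g3, g4, g5, g6⟩ := hT.parent x k h1 hs
    obtain ⟨m', f1, f2, f3, f4⟩ := exists_updateSubtree (v := v) r g2
    refine ⟨p, m', h2.trans g1, f1, g3, g4, by rw [h3, f3, g5], ?_⟩
    by_cases hvp : T.InSubtree v p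
    · have hvx : T.InSubtree v x := hvp.tail ⟨k, h1, g1⟩
      rw [if_pos hvp] at f4
      rw [if_pos hvx] at h4
      obtain ⟨m₀, e1, -, -, e4⟩ := hT.of_inSubtree P.consistent_zero hvp g2
      rw [hv] at e1
      cases e1
      -- This keeps the truncated subtraction `m.b - 1` honest.
      have : 1 ≤ m.b := by
        rcases e4 with rfl | ⟨-, -, e4⟩
        · rw [hv] at g2
          cases g2
          omega
        · omega
      exact .inl (by omega)
    · rw [if_neg hvp] at f4
      by_cases hvx : T.InSubtree v x
      · rw [if_pos hvx] at h4
        -- Only the root of a subtree has its parent outside; its edge is the one just evaluated.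
        obtain rfl : v = x := by
          rcases Relation.ReflTransGen.cases_tail hvx with h | ⟨q, h, k₀, e1, e2⟩
          · exact h.symm
          · rw [h1] at e1
            cases e1
            rw [g1] at e2
            cases e2
            exact absurd h hvp
        rw [hv] at h1
        cases h1
        rw [hp] at g1
        cases g1
        exact .inr ⟨by omega, by omega, .inl rfl, hw⟩
      · rw [if_neg hvx] at h4
        rcases g6 with g6 | ⟨e1, e2, e3, e4⟩
        · exact .inl (by omega)
        · exact .inr ⟨by omega, by omega, .inr e3, e4⟩
  band := by
    intro x k' hx
    obtain ⟨k, h1, -, -, h4⟩ := updateSubtree_eq_some hx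
    refine le_trans ?_ (hT.band x k h1)
    have : k'.b ≤ k.b := by split_ifs at h4 <;> omega
    exact_mod_cast this
  settled := by
    intro x k' hx h0
    obtain ⟨k, h1, -, h3, -⟩ := updateSubtree_eq_some hx
    rw [h3]
    rcases (hT.settled_updateSubtree r hv hb).1 ⟨k', hx, h0⟩ with rfl | ⟨k₂, h2, h5⟩
    · rw [hv] at h1
      cases h1
      exact hs
    · rw [h1] at h2
      cases h2
      exact hT.settled x k h1 h5

theorem settled_extendsTo [Finite V] (hT : P.IsSearchTree α E F T) {T' : SearchTree V}
    (h : P.ExtendsTo α E T T') {x : V} : Settled T' x ↔ Settled T x :=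
  exists_congr fun n => and_congr_left fun hb => (hT.of_reflTransGen h.1).2 x n hb

/-! ### Frontier nodes and popped nodes -/

/-- In a fully extended band, a walk either stays inside the tree, or its key is at least that of
a frontier node. -/
theorem exists_frontier_of_reaches (hT : P.IsSearchTree α E F T) (hα : 1 ≤ α)
    (hcl : ∀ u v m, ¬ P.CanRelax α E T u v m) (ht : ¬ Settled T P.target) {h : V → ℝ}
    (hc : P.Consistent h) {v : V} {r : ℝ} (hr : P.Reaches E v r) :
    (∃ n, T v = some n ∧ n.cost ≤ r) ∨ ∃ y n, P.IsFrontier α T y n ∧ n.cost + h y ≤ r + h v := by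
  induction hr with
  | source =>
    obtain ⟨n, h1, -, h3, -⟩ := hT.root
    exact .inl ⟨n, h1, h3.le⟩
  | @step u v r _ he ih =>
    have hh := hc.2 _ _ (hT.edges_subset he)
    rcases ih with ⟨n, h1, h2⟩ | ⟨y, n, h1, h2⟩
    · by_cases hf : u ≠ P.target ∧ (n.b : ℕ∞) < α
      · have := hcl u v n
        simp only [CanRelax, not_and, not_forall, not_lt] at this
        obtain ⟨k, h3, h4⟩ := this h1 hf.2 hf.1 he
        exact .inl ⟨k, h3, by linarith⟩
      -- A node that may not be expanded is a frontier node: as `0 < α`, budget `0` would make it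
      -- the settled target, which is excluded.
      · refine .inr ⟨u, n, ⟨h1, ?_, ?_⟩, by linarith⟩
        · rcases Nat.eq_zero_or_pos n.b with h0 | h0
          · exfalso
            by_cases hu : u = P.target
            · exact ht ⟨n, hu ▸ h1, h0⟩
            · refine hf ⟨hu, ?_⟩
              rw [h0]
              exact lt_of_lt_of_le (by simp) hα
          · exact h0
        · by_contra! hcon
          exact hf ⟨hcon.2, lt_of_le_of_ne (hT.band u n h1) hcon.1⟩
    · exact .inr ⟨y, n, h1, by linarith⟩

/-- The tree path of a popped node consists of cheapest walks. -/
theorem isShortest_of_isPopped (hT : P.IsSearchTree α E F T) (hα : 1 ≤ α)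
    (hcl : ∀ u v m, ¬ P.CanRelax α E T u v m) (ht : ¬ Settled T P.target) {h : V → ℝ}
    (hc : P.Consistent h) {x y : V} (hx : P.IsPopped α h T x) (hy : T.InSubtree y x)
    {k : TreeNode V} (hk : T y = some k) : P.IsShortest E y k.cost := by
  intro r hr
  by_contra! hlt
  obtain ⟨n, hn, hmin⟩ := hx
  obtain ⟨k', h1, -, h3, -⟩ := hT.of_inSubtree hc hy hn.1
  rw [hk] at h1
  cases h1
  -- A cheaper walk to `y` would either contradict the cost of `y` in the tree or produce a frontier
  -- node with key below that of `x`, since keys do not decrease from `y` to `x`.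
  rcases hT.exists_frontier_of_reaches hα hcl ht hc hr with ⟨k', h4, h5⟩ | ⟨z, m, h4, h5⟩
  · rw [hk] at h4
    cases h4
    linarith
  · have := hmin z m h4
    linarith

theorem exists_firstLazyEdge [Finite V] (hT : P.IsSearchTree α E F T) {x : V} {n : TreeNode V}
    (hx : T x = some n) (hb : 0 < n.b) : ∃ u v, IsFirstLazyEdge T x u v := by
  refine hT.induction (p := fun x n => 0 < n.b → ∃ u v, IsFirstLazyEdge T x u v) ?_ ?_ hx hb
  · intro n _ _ h0 h1
    omega
  · intro u m v n hu hv hp _ _ _ hbud ih hpos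
    rcases Nat.eq_zero_or_pos m.b with h0 | h0
    · exact ⟨u, v, .refl, n, hv, hp, by omega⟩
    · obtain ⟨u', v', h1, h2⟩ := ih h0
      exact ⟨u', v', h1.tail ⟨n, hv, hp⟩, h2⟩

end IsSearchTree

/-! ### The invariant of the states and termination of runs -/

/-- The invariant of the states of LRA*. -/
structure IsReachable (P : LazyProblem V) (α : ℕ∞) (h : V → ℝ) (s : State V) : Prop where
  tree : P.IsSearchTree α s.edges s.evaluated s.tree
  closed : ∀ u v m, ¬ P.CanRelax α s.edges s.tree u v m
  removed : ∀ u v, P.graph.Adj u v → (u, v) ∉ s.edges →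
    (u, v) ∈ s.evaluated ∧ P.collides u v ∧ Settled s.tree u
  collides : ∀ u v, (u, v) ∈ s.evaluated → P.collides u v → (u, v) ∉ s.edges
  free : ∀ u v, (u, v) ∈ s.evaluated → ¬ P.collides u v → Settled s.tree v
  target : ¬ s.found → ¬ Settled s.tree P.target
  found : s.found → ∃ n, s.tree P.target = some n ∧ n.b = 0 ∧
    ∀ y k, P.IsFrontier α s.tree y k → n.cost ≤ k.cost + h y

theorem not_collides_of_w_eq {u v : V} (hw : P.w u v = (P.wHat u v : EReal)) :
    ¬ P.collides u v := by
  intro h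
  simp [w, h] at hw

theorem collides_of_w_ne {u v : V} (hw : P.w u v ≠ (P.wHat u v : EReal)) : P.collides u v := by
  by_contra h
  simp [w, h] at hw

theorem isSearchTree_rootTree (P : LazyProblem V) (α : ℕ∞) :
    P.IsSearchTree α P.edgeSet ∅ P.rootTree := by
  have key : ∀ v n, P.rootTree v = some n → v = P.source ∧ n = ⟨none, 0, 0, 0⟩ := by
    intro v n h
    by_cases hv : v = P.source
    · simp only [rootTree, hv, if_true, Option.some.injEq] at h
      exact ⟨hv, h.symm⟩
    · simp [rootTree, hv] at h
  have hpos : ∀ v r, P.Reaches P.edgeSet v r → 0 ≤ r := by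
    intro v r hr
    induction hr with
    | source => exact le_rfl
    | @step u v r _ he ih =>
      have := P.wHat_pos u v he
      linarith
  refine ⟨subset_rfl, ⟨⟨none, 0, 0, 0⟩, by simp [rootTree], rfl, by simp [TreeNode.cost], rfl⟩,
    fun v n h hv => absurd (key v n h).1 hv, ?_, ?_⟩
  · intro v n h
    simp [(key v n h).2]
  · intro v n h _ r hr
    simpa [(key v n h).2, TreeNode.cost] using hpos v r hr

theorem IsInitial.isReachable [Finite V] (hst : P.source ≠ P.target) {α : ℕ∞} {h : V → ℝ}
    {s : State V} (hs : P.IsInitial α s) : P.IsReachable α h s := by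
  obtain ⟨h1, h2, h3, h4⟩ := hs
  have hT := P.isSearchTree_rootTree α
  refine ⟨?_, ?_, ?_, ?_, ?_, ?_, fun hf => absurd hf h4⟩
  · rw [h1, h3]
    exact (hT.of_reflTransGen h2.1).1
  · rw [h1]
    exact h2.2
  · intro u v hadj hn
    rw [h1] at hn
    exact absurd hadj hn
  · simp [h3]
  · simp [h3]
  · rw [hT.settled_extendsTo h2]
    rintro - ⟨n, hn, -⟩
    simp [rootTree, hst.symm] at hn

namespace IsReachable

variable {α : ℕ∞} {h : V → ℝ} {s : State V}

/-- The vertex `v` lies on the path of a popped node, so its cost is cheapest, as is required of a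
vertex about to be settled. -/
theorem updateSubtree [Finite V] (hs : P.IsReachable α h s) (hα : 1 ≤ α) (hc : P.Consistent h)
    (hf : ¬ s.found) {x u v : V} (hx : P.IsPopped α h s.tree x)
    (he : IsFirstLazyEdge s.tree x u v) (hw : P.w u v = (P.wHat u v : EReal)) :
    P.IsSearchTree α s.edges (insert (u, v) s.evaluated)
      (s.tree.updateSubtree v (P.wHat u v)) := by
  obtain ⟨hvx, n, hn, hp, hb⟩ := he
  exact hs.tree.updateSubtree _ hn hp hb (not_collides_of_w_eq hw)
    (hs.tree.isShortest_of_isPopped hα hs.closed (hs.target hf) hc hx hvx hn)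

theorem parent_settled (hs : P.IsReachable α h s) {x u v : V}
    (he : IsFirstLazyEdge s.tree x u v) : Settled s.tree u ∧ (u, v) ∈ s.edges := by
  obtain ⟨-, n, hn, hp, hb⟩ := he
  obtain ⟨k, m, h1, -, h3, h4, -, -, h7⟩ := hs.tree.of_isChild ⟨n, hn, hp⟩
  rw [hn] at h1
  cases h1
  exact ⟨⟨m, h3, by omega⟩, h4⟩

/-- The common part of the two collision-free cases of `step`; `p` is the new value of `found`. -/
theorem of_free [Finite V] (hs : P.IsReachable α h s) {u v : V} {T' : SearchTree V}
    (hw : ¬ P.collides u v)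
    (hT' : P.IsSearchTree α s.edges (insert (u, v) s.evaluated) T')
    (hset : ∀ x, Settled T' x ↔ x = v ∨ Settled s.tree x)
    (hcl : ∀ u v m, ¬ P.CanRelax α s.edges T' u v m) {p : Prop}
    (ht : ¬ p → ¬ Settled T' P.target)
    (hp : p → ∃ n, T' P.target = some n ∧ n.b = 0 ∧
      ∀ y k, P.IsFrontier α T' y k → n.cost ≤ k.cost + h y) :
    P.IsReachable α h ⟨s.edges, T', insert (u, v) s.evaluated, p⟩ where
  tree := hT'
  closed := hcl
  removed := by
    intro a b hab hn
    obtain ⟨h1, h2, h3⟩ := hs.removed a b hab hn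
    exact ⟨.inr h1, h2, (hset _).2 (.inr h3)⟩
  collides := by
    intro a b hab hcol
    rcases hab with hab | hab
    · cases hab
      exact absurd hcol hw
    · exact hs.collides a b hab hcol
  free := by
    intro a b hab hcol
    rcases hab with hab | hab
    · cases hab
      exact (hset _).2 (.inl rfl)
    · exact (hset _).2 (.inr (hs.free a b hab hcol))
  target := ht
  found := hp

theorem step [Finite V] (hs : P.IsReachable α h s) (hα : 1 ≤ α) (hc : P.Consistent h)
    {s' : State V} (hstep : P.Step α h s s') : P.IsReachable α h s' := by
  cases hstep with
  | reach x u v hf hx he hw hv =>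
    obtain ⟨hvx, n, hn, hp, hb⟩ := id he
    have hset := fun x => hs.tree.settled_updateSubtree (x := x) (P.wHat u v) hn hb
    -- The target is never expanded, so the update affects its node alone and the band stays closed.
    have hsub : ∀ y k, s.tree.InSubtree v y → s.tree y = some k → y = v := by
      intro y k hy hk
      obtain ⟨m, -, -, -, h4⟩ := hs.tree.of_inSubtree hc hy hk
      rcases h4 with h4 | ⟨-, h4, -⟩
      · exact h4.symm
      · exact absurd hv h4
    refine hs.of_free (not_collides_of_w_eq hw)
      (hs.updateSubtree hα hc hf hx he hw) hset ?_ (fun h => absurd trivial h) fun _ => ?_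
    · rintro a b m ⟨h1, h2, h3, h4, h5⟩
      obtain ⟨k, g1, -, g3, g4⟩ := updateSubtree_eq_some h1
      rw [if_neg fun hsub' => h3 ((hsub _ _ hsub' g1).trans hv)] at g4
      refine hs.closed a b k ⟨g1, g4 ▸ h2, h3, h4, fun n' hn' => ?_⟩
      obtain ⟨k', f1, -, f3, -⟩ := exists_updateSubtree (v := v) (P.wHat u v) hn'
      have := h5 _ f1
      rwa [g3, f3] at this
    · obtain ⟨n', g1, -, g3, g4⟩ := exists_updateSubtree (v := v) (P.wHat u v) hn
      rw [if_pos .refl, hb] at g4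
      rw [← hv]
      refine ⟨n', g1, g4, ?_⟩
      rintro y k ⟨h1, h2, h3⟩
      obtain ⟨k', f1, -, f3, f4⟩ := updateSubtree_eq_some h1
      have hyv : ¬ s.tree.InSubtree v y := by
        intro hy
        obtain rfl := hsub _ _ hy f1
        rw [g1] at h1
        cases h1
        omega
      rw [if_neg hyv] at f4
      -- The popped node is the target itself, and `h` vanishes there, so its cost is the minimal
      -- key.
      obtain ⟨m, hm, hmin⟩ := hx
      obtain rfl := hsub _ _ hvx hm.1
      obtain ⟨hm, -⟩ := hm
      rw [hn] at hm
      cases hm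
      have := hmin y k' ⟨f1, f4 ▸ h2, f4 ▸ h3⟩
      rw [hv, hc.1] at this
      rw [g3, f3]
      linarith
  | free x u v T' hf hx he hw hv hT =>
    obtain ⟨hvx, n, hn, hp, hb⟩ := id he
    have hup := hs.updateSubtree hα hc hf hx he hw
    have hset : ∀ x, Settled T' x ↔ x = v ∨ Settled s.tree x := fun x =>
      (hup.settled_extendsTo hT).trans (hs.tree.settled_updateSubtree _ hn hb)
    refine hs.of_free (not_collides_of_w_eq hw)
      (hup.of_reflTransGen hT.1).1 hset hT.2 (fun _ => ?_) fun hf => hf.elim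
    rw [hset]
    rintro (h | h)
    · exact hv h.symm
    · exact hs.target hf h
  | collision x u v T' hf hx he hw hT =>
    obtain ⟨hvx, n, hn, hp, hb⟩ := id he
    have hrem := hs.tree.removeSubtree (u := u) hn hb
    have hset : ∀ x, Settled T' x ↔ Settled s.tree x := fun x =>
      (hrem.settled_extendsTo hT).trans (hs.tree.settled_removeSubtree hn hb)
    refine ⟨(hrem.of_reflTransGen hT.1).1, hT.2, ?_, ?_, ?_, fun _ => ?_, fun hf => hf.elim⟩
    · intro a b hab hnot
      by_cases heq : (a, b) = (u, v)
      · cases heq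
        exact ⟨.inl rfl, collides_of_w_ne hw, (hset _).2 (hs.parent_settled he).1⟩
      · obtain ⟨h1, h2, h3⟩ := hs.removed a b hab fun h => hnot ⟨h, heq⟩
        exact ⟨.inr h1, h2, (hset _).2 h3⟩
    · rintro a b (hab | hab) hcol hmem
      · exact hmem.2 hab
      · exact hs.collides a b hab hcol hmem.1
    · rintro a b (hab | hab) hcol
      · cases hab
        exact absurd (collides_of_w_ne hw) hcol
      · exact (hset _).2 (hs.free a b hab hcol)
    · rw [hset]
      exact hs.target hf

/-- The number of unsettled vertices plus the number of remaining edges drops in every iteration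
that does not halt. -/
theorem exists_halted [Finite V] (hs : P.IsReachable α h s) (hα : 1 ≤ α) (hc : P.Consistent h) :
    ∃ s', Relation.ReflTransGen (P.Step α h) s s' ∧ P.IsHalted α s' := by
  induction hk : {x | ¬ Settled s.tree x}.ncard + s.edges.ncard using Nat.strong_induction_on
    generalizing s with
  | _ k ih =>
    subst hk
    by_cases hh : P.IsHalted α s
    · exact ⟨s, .refl, hh⟩
    · simp only [IsHalted, not_or, not_forall, not_not] at hh
      obtain ⟨hf, hex⟩ := hh
      have hpop : ∃ x, P.IsPopped α h s.tree x := by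
        -- The default value `0` is never taken, since frontier vertices have nodes.
        obtain ⟨y, hy, hmin⟩ := Set.exists_min_image {y | ∃ k, P.IsFrontier α s.tree y k}
          (fun y => (s.tree y).elim 0 TreeNode.cost + h y) (Set.toFinite _) hex
        obtain ⟨n, hn⟩ := hy
        refine ⟨y, n, hn, fun z k hz => ?_⟩
        simpa [hn.1, hz.1] using hmin z ⟨k, hz⟩
      obtain ⟨x, hx⟩ := hpop
      obtain ⟨m, hm, -⟩ := id hx
      obtain ⟨u, v, he⟩ := hs.tree.exists_firstLazyEdge hm.1 hm.2.1
      obtain ⟨-, n, hn, hp, hb⟩ := id he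
      by_cases hw : P.w u v = (P.wHat u v : EReal)
      · by_cases hv : v = P.target
        · exact ⟨_, .single (.reach s x u v hf hx he hw hv), .inl trivial⟩
        · have hup := hs.updateSubtree hα hc hf hx he hw
          obtain ⟨T', hT⟩ := hup.exists_extendsTo
          have hstep := Step.free s x u v T' hf hx he hw hv hT
          have hset : ∀ x, Settled T' x ↔ x = v ∨ Settled s.tree x := fun x =>
            (hup.settled_extendsTo hT).trans (hs.tree.settled_updateSubtree _ hn hb)
          obtain ⟨s', h1, h2⟩ := ih _ (by
            refine Nat.add_lt_add_right (Set.ncard_lt_ncard ?_ (Set.toFinite _)) _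
            refine (Set.ssubset_iff_of_subset ?_).2 ⟨v, ?_, ?_⟩
            · intro y hy hy'
              exact hy ((hset y).2 (.inr hy'))
            · rintro ⟨k, h1, h2⟩
              rw [hn] at h1
              cases h1
              omega
            · exact fun h => h ((hset v).2 (.inl rfl))) (hs.step hα hc hstep) rfl
          exact ⟨s', .head hstep h1, h2⟩
      · have hrem := hs.tree.removeSubtree (u := u) hn hb
        obtain ⟨T', hT⟩ := hrem.exists_extendsTo
        have hstep := Step.collision s x u v T' hf hx he hw hT
        have hset : ∀ x, Settled T' x ↔ Settled s.tree x := fun x =>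
          (hrem.settled_extendsTo hT).trans (hs.tree.settled_removeSubtree hn hb)
        obtain ⟨s', h1, h2⟩ := ih _ (by
          simp only [hset]
          exact Nat.add_lt_add_left
            (Set.ncard_sdiff_singleton_lt_of_mem (hs.parent_settled he).2 (Set.toFinite _)) _)
            (hs.step hα hc hstep) rfl
        exact ⟨s', .head hstep h1, h2⟩

theorem of_reflTransGen [Finite V] (hs : P.IsReachable α h s) (hα : 1 ≤ α)
    (hc : P.Consistent h) {s' : State V} (hr : Relation.ReflTransGen (P.Step α h) s s') :
    P.IsReachable α h s' := by
  induction hr with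
  | refl => exact hs
  | tail _ hstep ih => exact ih.step hα hc hstep

end IsReachable

theorem exists_isEvaluatedSet [Finite V] (hst : P.source ≠ P.target) {α : ℕ∞} (hα : 1 ≤ α)
    {h : V → ℝ} (hc : P.Consistent h) : ∃ E, P.IsEvaluatedSet α h E := by
  obtain ⟨T, hT⟩ := (P.isSearchTree_rootTree α).exists_extendsTo
  have hini : P.IsInitial α ⟨P.edgeSet, T, ∅, False⟩ := ⟨rfl, hT, rfl, id⟩
  obtain ⟨s', h1, h2⟩ := (hini.isReachable (h := h) hst).exists_halted hα hc
  exact ⟨_, _, s', hini, h1, h2, rfl⟩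

/-! ### Comparison of the two runs -/

section Comparison

variable {α : ℕ∞} {h₁ h₂ : V → ℝ} {s₁ s₂ : State V}

/-- If everything evaluated in `s₁` is evaluated in `s₂`, the current graph of `s₂` is smaller. -/
theorem IsReachable.edges_anti (hs₁ : P.IsReachable α h₁ s₁) (hs₂ : P.IsReachable α h₂ s₂)
    (hsub : s₁.evaluated ⊆ s₂.evaluated) : s₂.edges ⊆ s₁.edges := by
  rintro ⟨u, v⟩ he
  by_contra hn
  obtain ⟨h1, h2, -⟩ := hs₁.removed u v (hs₂.tree.edges_subset he) hn
  exact hs₂.collides u v (hsub h1) h2 he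

/-- Settled nodes of `s₁` are settled in `s₂`, at the same cost. -/
theorem IsReachable.settled_transfer [Finite V] (hs₁ : P.IsReachable α h₁ s₁)
    (hs₂ : P.IsReachable α h₂ s₂) (hsub : s₁.evaluated ⊆ s₂.evaluated) {v : V} {n : TreeNode V}
    (hn : s₁.tree v = some n) (hb : n.b = 0) :
    ∃ k, s₂.tree v = some k ∧ k.b = 0 ∧ k.cost = n.cost := by
  refine hs₁.tree.induction (p := fun v n => n.b = 0 → ∃ k, s₂.tree v = some k ∧ k.b = 0 ∧
    k.cost = n.cost) ?_ ?_ hn hb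
  · intro n _ hc _ _
    obtain ⟨k, h1, -, h3, h4⟩ := hs₂.tree.root
    exact ⟨k, h1, h4, by rw [h3, hc]⟩
  · intro u m v n hu hv hp he _ hc hbud ih h0
    obtain ⟨hm0, heval, hcol⟩ : m.b = 0 ∧ (u, v) ∈ s₁.evaluated ∧ ¬ P.collides u v := by
      rcases hbud with h | ⟨-, h⟩
      · omega
      · exact h
    obtain ⟨k, h1, h2, h3⟩ := ih hm0
    obtain ⟨k', g1, g2⟩ := hs₂.free u v (hsub heval) hcol
    have he₂ : (u, v) ∈ s₂.edges := by
      by_contra hne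
      exact hcol (hs₂.removed u v (hs₁.tree.edges_subset he) hne).2.1
    -- Both costs are cheapest, each in its own graph: the walk to `u` in `s₂` extended by `(u, v)`
    -- bounds one, and `s₂.edges ⊆ s₁.edges` bounds the other.
    refine ⟨k', g1, g2, le_antisymm ?_ ?_⟩
    · rw [hc, ← h3]
      exact hs₂.tree.settled v k' g1 g2 _ (.step (hs₂.tree.reaches h1) he₂)
    · exact hs₁.tree.settled v n hv h0 _
        ((hs₂.tree.reaches g1).mono (hs₁.edges_anti hs₂ hsub))

/-- A cheapest tree edge of `s₁` that is still present in `s₂` is a tree edge of `s₂` if its tail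
has the same cost in both trees. -/
theorem IsReachable.child_transfer [Finite V] (hties : P.NoTies) (hs₁ : P.IsReachable α h₁ s₁)
    (hs₂ : P.IsReachable α h₂ s₂) (hsub : s₁.evaluated ⊆ s₂.evaluated) {u v : V}
    {n m m₂ : TreeNode V} (hn : s₁.tree v = some n) (hm : s₁.tree u = some m)
    (hut : u ≠ P.target) (hc : n.cost = m.cost + P.wHat u v) (hb : n.b = m.b + 1)
    (hshort : P.IsShortest s₁.edges v n.cost) (he : (u, v) ∈ s₂.edges)
    (hm₂ : s₂.tree u = some m₂) (hc₂ : m₂.cost = m.cost) (hb₂ : m₂.b = m.b)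
    (hlazy : m₂.b = 0 → (u, v) ∉ s₂.evaluated) :
    ∃ n₂, s₂.tree v = some n₂ ∧ n₂.cost = n.cost ∧ n₂.b = n.b := by
  have hE := hs₁.edges_anti hs₂ hsub
  have hlt : (m₂.b : ℕ∞) < α := by
    refine lt_of_lt_of_le ?_ (hs₁.tree.band v n hn)
    rw [hb, hb₂]
    exact_mod_cast Nat.lt_succ_self _
  have hrel := hs₂.closed u v m₂
  simp only [CanRelax, not_and, not_forall, not_lt] at hrel
  obtain ⟨n₂, hn₂, hle⟩ := hrel hm₂ hlt hut he
  -- The closed band of `s₂` gives `≤`; cheapness in the larger graph of `s₁` gives `≥`.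
  have hcost : n₂.cost = n.cost :=
    le_antisymm (by rw [hc, ← hc₂]; exact hle) (hshort _ ((hs₂.tree.reaches hn₂).mono hE))
  have hpos := hs₂.tree.wHat_pos he
  have hvs : v ≠ P.source := by
    rintro rfl
    obtain ⟨k, h1, -, h3, -⟩ := hs₂.tree.root
    rw [hn₂] at h1
    cases h1
    have := hs₁.tree.cost_nonneg hm
    linarith
  obtain ⟨u', m', -, hu', he', -, hc', hb'⟩ := hs₂.tree.parent v n₂ hn₂ hvs
  obtain rfl : u = u' := by
    refine hties.parent_unique hs₁.tree.edges_subset (hs₁.tree.reaches hm)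
      ((hs₂.tree.reaches hu').mono hE) (hE he) (hE he') ?_ ?_
    · rw [← hc, ← hc', hcost]
    · rwa [← hc]
  rw [hm₂] at hu'
  cases hu'
  -- With the same parent the budgets agree, unless `(u, v)` was already evaluated in `s₂`, which
  -- `hlazy` rules out.
  refine ⟨n₂, hn₂, hcost, ?_⟩
  rcases hb' with hb' | ⟨-, h0, hev, -⟩
  · omega
  · exact absurd hev (hlazy h0)

/-- The next edge evaluated from `s₁` with the larger heuristic is evaluated by every complete run
with the smaller one. -/
theorem IsReachable.mem_evaluated [Finite V] (hties : P.NoTies) (hα : 1 ≤ α)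
    (hc₁ : P.Consistent h₁) (hdom : ∀ v, v ≠ P.target → h₂ v < h₁ v)
    (hs₁ : P.IsReachable α h₁ s₁) (hs₂ : P.IsReachable α h₂ s₂) (hf : ¬ s₁.found)
    (hhalt : P.IsHalted α s₂) (hsub : s₁.evaluated ⊆ s₂.evaluated) {x u v : V}
    (hx : P.IsPopped α h₁ s₁.tree x) (he : IsFirstLazyEdge s₁.tree x u v) :
    (u, v) ∈ s₂.evaluated := by
  by_contra hnot
  have hE := hs₁.edges_anti hs₂ hsub
  -- On the lazy tail this applies to the first edge because it is not evaluated in `s₂`, and to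
  -- later edges because their tail vertices have positive budget in `s₂`.
  have hedge : ∀ {a b}, (a, b) ∈ s₁.edges → ¬ ((a, b) ∈ s₂.evaluated ∧ Settled s₂.tree a) →
      (a, b) ∈ s₂.edges := by
    intro a b hab hno
    by_contra h
    obtain ⟨g1, -, g3⟩ := hs₂.removed a b (hs₁.tree.edges_subset hab) h
    exact hno ⟨g1, g3⟩
  obtain ⟨hvx, n, hn, hp, hb⟩ := he
  have chain : ∀ y, s₁.tree.InSubtree v y → s₁.tree.InSubtree y x → ∃ k k₂, s₁.tree y = some k ∧
      s₂.tree y = some k₂ ∧ k₂.cost = k.cost ∧ k₂.b = k.b ∧ 1 ≤ k.b := by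
    intro y hvy hyx
    induction hvy with
    | refl =>
      obtain ⟨n', m, h1, -, h3, h4, h5, h6, h7⟩ := hs₁.tree.of_isChild ⟨n, hn, hp⟩
      rw [hn] at h1
      cases h1
      have hm0 : m.b = 0 := by omega
      obtain ⟨m₂, g1, g2, g3⟩ := hs₁.settled_transfer hs₂ hsub h3 hm0
      obtain ⟨n₂, f1, f2, f3⟩ := hs₁.child_transfer hties hs₂ hsub hn h3 h5 h6 (by omega)
        (hs₁.tree.isShortest_of_isPopped hα hs₁.closed (hs₁.target hf) hc₁ hx hvx hn)
        (hedge h4 fun h => hnot h.1) g1 g3 (by omega) fun _ => hnot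
      exact ⟨n, n₂, hn, f1, f2, f3, hb.ge⟩
    | @tail y z hvy hyz ih =>
      obtain ⟨m, m₂, g1, g2, g3, g4, g5⟩ := ih (.head hyz hyx)
      obtain ⟨k, m', h1, -, h3, h4, h5, h6, h7⟩ := hs₁.tree.of_isChild hyz
      rw [g1] at h3
      cases h3
      obtain ⟨k₂, f1, f2, f3⟩ := hs₁.child_transfer hties hs₂ hsub h1 g1 h5 h6 (by omega)
        (hs₁.tree.isShortest_of_isPopped hα hs₁.closed (hs₁.target hf) hc₁ hx hyx h1)
        (hedge h4 fun ⟨_, q, e1, e2⟩ => by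
          rw [g2] at e1
          cases e1
          omega) g2 g3 g4 fun h => by omega
      exact ⟨k, k₂, h1, f1, f2, f3, by omega⟩
  obtain ⟨k, k₂, h1, h2, h3, h4, h5⟩ := chain x hvx .refl
  obtain ⟨k', hk', hmin⟩ := hx
  have := hk'.1
  rw [h1] at this
  cases this
  have hfr : P.IsFrontier α s₂.tree x k₂ := ⟨h2, by omega, h4 ▸ hk'.2.2⟩
  rcases hhalt with hfound | hempty
  · obtain ⟨t, ht, ht0, htmin⟩ := hs₂.found hfound
    have hxt : x ≠ P.target := by
      rintro rfl
      rw [ht] at h2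
      cases h2
      omega
    -- The target path found in `s₂` is also a walk in the graph of `s₁`, so some frontier node of
    -- `s₁` has key at most `t.cost`.
    have hle : k.cost + h₁ x ≤ t.cost := by
      have ht₁ := hc₁.1
      rcases hs₁.tree.exists_frontier_of_reaches hα hs₁.closed (hs₁.target hf) hc₁
        ((hs₂.tree.reaches ht).mono hE) with ⟨q, g1, g2⟩ | ⟨y, q, g1, g2⟩
      · have hq : 0 < q.b := Nat.pos_of_ne_zero fun h => hs₁.target hf ⟨q, g1, h⟩
        have := hmin _ q ⟨g1, hq, .inr rfl⟩
        linarith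
      · have := hmin y q g1
        linarith
    have := htmin x k₂ hfr
    have := hdom x hxt
    linarith
  · exact hempty x k₂ hfr

end Comparison

/-! ### The degenerate case and the conclusion -/

/-- If the source is the target, nothing is evaluated. -/
theorem isEvaluatedSet_iff_of_source_eq_target (hst : P.source = P.target) {α : ℕ∞}
    {h : V → ℝ} {E : Set (V × V)} : P.IsEvaluatedSet α h E ↔ E = ∅ := by
  have key : ∀ v n, P.rootTree v = some n → v = P.target ∧ n.b = 0 := by
    intro v n hv
    by_cases hs : v = P.source
    · simp only [rootTree, hs, if_true, Option.some.injEq] at hv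
      exact ⟨hs.trans hst, by rw [← hv]⟩
    · simp [rootTree, hs] at hv
  have hcl : ∀ u v m, ¬ P.CanRelax α P.edgeSet P.rootTree u v m :=
    fun u v m hr => hr.2.2.1 (key u m hr.1).1
  have hfr : ∀ x n, ¬ P.IsFrontier α P.rootTree x n := fun x n hf =>
    hf.2.1.ne' (key x n hf.1).2
  constructor
  · rintro ⟨s₀, s, ⟨-, ⟨h2, -⟩, h3, -⟩, hr, -, rfl⟩
    have hroot : s₀.tree = P.rootTree := by
      rcases Relation.ReflTransGen.cases_head h2 with h | ⟨T, ⟨u, v, m, hm⟩, -⟩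
      · exact h.symm
      · exact absurd hm (hcl u v m)
    have hpop : ∀ x, ¬ P.IsPopped α h s₀.tree x := by
      rintro x ⟨n, hn, -⟩
      exact hfr x n (hroot ▸ hn)
    rcases Relation.ReflTransGen.cases_head hr with rfl | ⟨s', hstep, -⟩
    · exact h3
    · cases hstep with
      | reach x _ _ _ hx => exact absurd hx (hpop x)
      | free x _ _ _ _ hx => exact absurd hx (hpop x)
      | collision x _ _ _ _ hx => exact absurd hx (hpop x)
  · rintro rfl
    exact ⟨⟨P.edgeSet, P.rootTree, ∅, False⟩, _, ⟨rfl, ⟨.refl, hcl⟩, rfl, id⟩, .refl,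
      .inr hfr, rfl⟩

/-- The induction follows the first run while the halted state `t` of the second stays fixed; the
runs need not be synchronised. -/
theorem IsEvaluatedSet.subset [Finite V] (hties : P.NoTies) {α : ℕ∞} (hα : 1 ≤ α)
    (hst : P.source ≠ P.target) {h₁ h₂ : V → ℝ} (hc₁ : P.Consistent h₁) (hc₂ : P.Consistent h₂)
    (hdom : ∀ v, v ≠ P.target → h₂ v < h₁ v) {E₁ E₂ : Set (V × V)}
    (hE₁ : P.IsEvaluatedSet α h₁ E₁) (hE₂ : P.IsEvaluatedSet α h₂ E₂) : E₁ ⊆ E₂ := by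
  obtain ⟨s₀, s, hi, hr, -, rfl⟩ := hE₁
  obtain ⟨t₀, t, ki, kr, kh, rfl⟩ := hE₂
  have ht : P.IsReachable α h₂ t := (ki.isReachable hst).of_reflTransGen hα hc₂ kr
  induction hr with
  | refl => simp [hi.2.2.1]
  | tail hr hstep ih =>
    have hs := (hi.isReachable (h := h₁) hst).of_reflTransGen hα hc₁ hr
    cases hstep <;>
      exact Set.insert_subset
        (hs.mem_evaluated hties hα hc₁ hdom ht ‹_› kh ih ‹_› ‹_›) ih

end LazyProblem

theorem mainTheorem4 {V : Type*} [Finite V] (P : LazyProblem V) (hties : P.NoTies)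
    (α : ℕ∞) (hα : 1 ≤ α) (h₁ h₂ : V → ℝ)
    (hc₁ : P.Consistent h₁) (hc₂ : P.Consistent h₂)
    (hadm : ∀ v, v ≠ P.target → (h₁ v : EReal) ≤ P.optHeuristic v)
    (hdom : ∀ v, v ≠ P.target → h₂ v < h₁ v) :
    (∃ E₁, P.IsEvaluatedSet α h₁ E₁) ∧ (∃ E₂, P.IsEvaluatedSet α h₂ E₂) ∧
      ∀ E₁ E₂ : Set (V × V),
        P.IsEvaluatedSet α h₁ E₁ → P.IsEvaluatedSet α h₂ E₂ → E₁ ⊆ E₂ := by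
  -- If they coincide, the target is settled from the start, against the field `target` of
  -- `IsReachable`.
  by_cases hst : P.source = P.target
  · simp only [LazyProblem.isEvaluatedSet_iff_of_source_eq_target hst]
    exact ⟨⟨_, rfl⟩, ⟨_, rfl⟩, by rintro E₁ E₂ rfl rfl; exact subset_rfl⟩
  · exact ⟨LazyProblem.exists_isEvaluatedSet hst hα hc₁,
      LazyProblem.exists_isEvaluatedSet hst hα hc₂,
      fun _ _ h h' => h.subset hties hα hst hc₁ hc₂ hdom h'⟩
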